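/- Let $D=(V,E)$ be a finite strongly connected directed multigraph with at least one edge (parallel edges and loops are allowed), $V=\{1,\dots,n\}$, and fix for each vertex $v$ a cyclic ordering of the out-edges of $v$; write $e^+$ for the edge following $e$. Let $d(i,j)$ be the number of edges from $i$ to $j$ and $d^+(i)$ the out-degree of $i$. The Laplacian $L_D\in\mathbb{Z}^{n\times n}$ has entries $L_D(i,j)=d(j,i)$ for $i\ne j$ and $L_D(i,i)=d(i,i)-d^+(i)$ (so $L_D(i,i)=-d^+(i)$ if there are no loops). Let $\mathbb{Z}^n_0=\{x\in\mathbb{Z}^n:\sum_i x_i=0\}$, $\mathrm{Im}(L_D)=\{L_Dz: z\in\mathbb{Z}^n\}\subseteq\mathbb{Z}^n_0$ and $\mathrm{Pic}^0(D)=\mathbb{Z}^n_0/\mathrm{Im}(L_D)$. A rotor configuration is a map $\varrho$ assigning to each vertex $v$ an edge with tail $v$. The rotor-router operation sends a pair $(w,\varrho)$, with $w\in V$, to $(w^+,\varrho^+)$, where $\varrho^+(w)=\varrho(w)^+$, $\varrho^+(v)=\varrho(v)$ for $v\ne w$, and $w^+$ is the head of $\varrho^+(w)$. A unicycle is a pair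 $(w,\varrho)$ such that the edge set $\{\varrho(v):v\in V\}$ contains a unique directed cycle and $w$ lies on it. A unicycle-orbit is an orbit of a unicycle under iteration of the rotor-router operation. For $w\in V$ let $\mathcal{T}(D,w)$ be the number of spanning in-arborescences of $D$ rooted at $w$, that is, of edge sets $A\subseteq E$ containing no directed cycle and such that for every $v\neq w$ there is a unique directed path from $v$ to $w$ with edges in $A$. Then $\mathrm{Pic}^0(D)$ is finite and its order equals the number of rotor-router unicycle-orbits of $D$. Moreover, there is a unique vector $\mathrm{per}_D\in\mathbb{Z}^n$ with nonnegative entries such that $L_D\,\mathrm{per}_D=0$ and the entries of $\mathrm{per}_D$ have no non-trivial common divisor; its entries are positive, and for every $w\in V$ $$|\mathrm{Pic}^0(D)|=\frac{\mathcal{T}(D,w)}{\mathrm{per}_D(w)}.$$ -/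

import Mathlib

/-- A directed multigraph with vertex set `V` and edge set `E`: the edge `e` points from its tail
`D.src e` to its head `D.tgt e`. Parallel edges and loops are allowed. -/
structure MultiDigraph (V E : Type*) where
  src : E → V
  tgt : E → V

namespace MultiDigraph

variable {V E : Type*} (D : MultiDigraph V E)

/-- Every vertex can be reached from every vertex along directed edges. -/
def StronglyConnected : Prop :=
  ∀ u v : V, Relation.ReflTransGen (fun a b => ∃ e, D.src e = a ∧ D.tgt e = b) u v

/-- The multiplicity `d(i, j)` of edges pointing from `i` to `j`. -/
noncomputable def mult (i j : V) : ℕ := Nat.card {e : E // D.src e = i ∧ D.tgt e = j}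

/-- The out-degree `d⁺(i)`. -/
noncomputable def outDeg (i : V) : ℕ := Nat.card {e : E // D.src e = i}

/-- The Laplacian matrix. The diagonal entry is `-d⁺(i)` when there is no loop at `i`; in general a
loop contributes `0`, so that all column sums vanish. -/
noncomputable def laplacian [DecidableEq V] : Matrix V V ℤ :=
  Matrix.of fun i j => if i = j then (D.mult i i : ℤ) - D.outDeg i else D.mult j i

/-- `p` is a primitive nonnegative integer vector in the kernel of the Laplacian. -/
structure IsPeriodVector [Fintype V] [DecidableEq V] (p : V → ℤ) : Prop where
  laplacian_mulVec : D.laplacian.mulVec p = 0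
  nonneg : ∀ v, 0 ≤ p v
  primitive : ∀ d : ℤ, (∀ v, d ∣ p v) → IsUnit d

/-! ### Directed cycles, paths and in-arborescences -/

/-- `C` is the edge set of a directed cycle `c 0, c 1, …, c n` (indices are cyclic, the vertices
are pairwise distinct; a loop is a cycle of length one). -/
def IsDirectedCycle (C : Set E) : Prop :=
  ∃ (n : ℕ) (c : Fin (n + 1) → E), Function.Injective (fun i => D.src (c i)) ∧
    (∀ i, D.tgt (c i) = D.src (c (i + 1))) ∧ C = Set.range c

/-- The edge list is a directed walk from the first to the second vertex, with all edges in `A`. -/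
def IsWalk (A : Set E) : V → V → List E → Prop
  | u, v, [] => u = v
  | u, v, e :: l => e ∈ A ∧ D.src e = u ∧ IsWalk A (D.tgt e) v l

/-- A directed path: a directed walk whose vertices are pairwise distinct. -/
def IsPath (A : Set E) (u v : V) (l : List E) : Prop :=
  D.IsWalk A u v l ∧ (l.map D.src ++ [v]).Nodup

/-- The spanning subdigraph with edge set `A` is an in-arborescence rooted at `w`. -/
def IsInArborescence (w : V) (A : Set E) : Prop :=
  (∀ C ⊆ A, ¬ D.IsDirectedCycle C) ∧ ∀ v, v ≠ w → ∃! l : List E, D.IsPath A v w l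

/-- The number `𝒯(D, w)` of spanning in-arborescences rooted at `w`. -/
noncomputable def numInArborescences (w : V) : ℕ := {A : Set E | D.IsInArborescence w A}.ncard

/-! ### Rotor-routing -/

/-- A choice of a cyclic ordering of the out-edges of each vertex: `next e` is the edge `e⁺`
following `e`. The cycles of the permutation `next` are exactly the sets of out-edges of the
vertices. -/
structure RotorOrder where
  next : Equiv.Perm E
  sameCycle_iff : ∀ e f, next.SameCycle e f ↔ D.src e = D.src f

/-- A rotor configuration on a digraph without sinks: an out-edge at each vertex. -/
def RotorConfig : Type _ := {ϱ : V → E // ∀ v, D.src (ϱ v) = v}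

/-- Chip-and-rotor configurations `(w, ϱ)`. -/
abbrev ChipRotorConfig : Type _ := V × D.RotorConfig

variable {D}

theorem RotorOrder.src_next (r : D.RotorOrder) (e : E) : D.src (r.next e) = D.src e :=
  ((r.sameCycle_iff e (r.next e)).1 (Equiv.Perm.sameCycle_apply_right.2 (.refl _ _))).symm

/-- Advance the rotor at `w` to the next edge in the cyclic order at `w`. -/
def RotorOrder.advance [DecidableEq V] (r : D.RotorOrder) (w : V) (ϱ : D.RotorConfig) :
    D.RotorConfig :=
  ⟨Function.update ϱ.1 w (r.next (ϱ.1 w)), fun v => by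
    by_cases h : v = w
    · subst h; simp [r.src_next, ϱ.2 v]
    · simp [h, ϱ.2 v]⟩

/-- The rotor-router operation `(w, ϱ) ↦ (w⁺, ϱ⁺)`: first the rotor at the chip is advanced, then
the chip moves along the new rotor. -/
def RotorOrder.step [DecidableEq V] (r : D.RotorOrder) (c : D.ChipRotorConfig) :
    D.ChipRotorConfig :=
  (D.tgt ((r.advance c.1 c.2).1 c.1), r.advance c.1 c.2)

variable (D) in
/-- `(w, ϱ)` is a unicycle: the set of edges `{ϱ(v)}` contains a unique directed cycle, and `w` lies
on this cycle. -/
def IsUnicycle (c : D.ChipRotorConfig) : Prop :=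
  ∃ C : Set E, (C ⊆ Set.range c.2.1 ∧ D.IsDirectedCycle C) ∧
    (∀ C' : Set E, C' ⊆ Set.range c.2.1 → D.IsDirectedCycle C' → C' = C) ∧
    ∃ e ∈ C, D.src e = c.1

/-- The rotor-router orbit of a configuration: everything reached by iterating the operation. -/
def RotorOrder.orbit [DecidableEq V] (r : D.RotorOrder) (c : D.ChipRotorConfig) :
    Set D.ChipRotorConfig :=
  {c' | ∃ k : ℕ, r.step^[k] c = c'}

/-- The number of rotor-router orbits of unicycles. -/
noncomputable def RotorOrder.numUnicycleOrbits [DecidableEq V] (r : D.RotorOrder) : ℕ :=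
  {O : Set D.ChipRotorConfig | ∃ c, D.IsUnicycle c ∧ O = r.orbit c}.ncard

/-! ### The Picard group -/

/-- The group of divisors of degree zero: integer vectors orthogonal to the all-ones vector. -/
def degreeZero (V : Type*) [Fintype V] : Submodule ℤ (V → ℤ) where
  carrier := {x | ∑ v, x v = 0}
  add_mem' := by
    intro a b ha hb
    simp only [Set.mem_ofPred_eq] at *
    simp [Finset.sum_add_distrib, ha, hb]
  zero_mem' := by simp
  smul_mem' := by
    intro c x hx
    simp only [Set.mem_ofPred_eq] at *
    simp [← Finset.mul_sum, hx]

variable (D) [Fintype V] [DecidableEq V]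

/-- The image `Im(L_D) = {L_D z : z ∈ ℤ^V}`. -/
noncomputable def imLaplacian : Submodule ℤ (V → ℤ) := LinearMap.range D.laplacian.mulVecLin

/-- The image of the Laplacian consists of divisors of degree zero. -/
theorem imLaplacian_le [Finite E] : D.imLaplacian ≤ degreeZero V := by
  classical
  have := Fintype.ofFinite E
  have hcol : ∀ j, ∑ i, D.laplacian i j = 0 := by
    intro j
    have hout : (D.outDeg j : ℤ) = ∑ i, (D.mult j i : ℤ) := by
      simp only [outDeg, mult, Nat.card_eq_fintype_card, Fintype.card_subtype]
      rw [Finset.card_eq_sum_card_fiberwise (f := D.tgt) (t := Finset.univ) (by simp)]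
      simp [Finset.filter_filter]
    have hL : ∀ i, D.laplacian i j = (D.mult j i : ℤ) - if i = j then (D.outDeg j : ℤ) else 0 := by
      intro i
      by_cases h : i = j
      · subst h; simp [laplacian]
      · simp [laplacian, h]
    simp [hL, Finset.sum_sub_distrib, hout]
  rintro _ ⟨z, rfl⟩
  change ∑ i, ∑ j, D.laplacian i j * z j = 0
  rw [Finset.sum_comm]
  simp [← Finset.sum_mul, hcol]

/-- The Picard group `Pic⁰(D) = ℤ^V₀ / Im(L_D)`. -/
abbrev Pic0 : Type _ := degreeZero V ⧸ D.imLaplacian.submoduleOf (degreeZero V)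

end MultiDigraph

namespace MultiDigraph

variable {V E : Type*} {D : MultiDigraph V E}

/-! A configuration `(w, ϱ)` is a unicycle exactly when the rotors lead from every vertex to `w`
(`isUnicycle_iff`). Dropping the rotor at `w` then leaves an in-arborescence rooted at `w`, so there
are `d⁺(w) · 𝒯(D, w)` unicycles with the chip at `w` (`card_isUnicycle`).

Routing is abelian: the number of times each rotor is advanced determines the final rotors
(`rotate`) and the net movement of chips (`flow`). The key lemma is `iterate_step_of_flow_eq`: if a
vector of rotations carries one chip to a unicycle, the rotor walk itself carries it out, with
exactly these visits. Full turns of the rotors change no rotor and move chips by an element of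
`Im(L_D)`.

Correcting the chip position by a potential of the rotors therefore gives an invariant in `Pic⁰(D)`,
which is surjective on unicycles and whose fibres are the orbits (`exists_classifying_map`). On a
unicycle the walk has a period in which each `v` is left `d⁺(v) · per(v)` times
(`period_of_isUnicycle`), so every orbit has `d⁺(w) · per(w)` members with the chip at `w`. Counting
these members twice gives `|Pic⁰(D)| · per(w) = 𝒯(D, w)`. The period vector itself is extracted from
a periodic stretch of some rotor walk; strong connectivity makes it positive and unique. -/

/-- The vertex to which the rotor at `v` points. -/
def RotorConfig.succ (ϱ : D.RotorConfig) (v : V) : V := D.tgt (ϱ.1 v)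

/-- Following the rotors of `ϱ` from `u` leads to `v`. -/
def RotorConfig.Reaches (ϱ : D.RotorConfig) (u v : V) : Prop := ∃ m, ϱ.succ^[m] u = v

theorem RotorConfig.Reaches.refl (ϱ : D.RotorConfig) (v : V) : ϱ.Reaches v v := ⟨0, rfl⟩

theorem RotorConfig.Reaches.head {ϱ : D.RotorConfig} {u v : V} (h : ϱ.Reaches (ϱ.succ u) v) :
    ϱ.Reaches u v := by
  obtain ⟨m, hm⟩ := h
  exact ⟨m + 1, by rwa [Function.iterate_succ_apply]⟩

/-- Induction backwards from the target. The rotor at `w` is never used, so the principle survives a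
change of that rotor. -/
theorem RotorConfig.Reaches.induction_on {ϱ : D.RotorConfig} {w : V} {P : V → Prop} {u : V}
    (h : ϱ.Reaches u w) (base : P w) (step : ∀ v, v ≠ w → P (ϱ.succ v) → P v) : P u := by
  obtain ⟨m, hm⟩ := h
  induction m generalizing u with
  | zero => obtain rfl : u = w := hm; exact base
  | succ m ih =>
    by_cases hu : u = w
    · exact hu ▸ base
    · exact step u hu (ih (by rwa [Function.iterate_succ_apply] at hm))

theorem RotorConfig.Reaches.mem_of_closed {ϱ : D.RotorConfig} {u w : V} (h : ϱ.Reaches u w)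
    {S : Set V} (hS : ∀ v ∈ S, ϱ.succ v ∈ S) (hu : u ∈ S) : w ∈ S := by
  obtain ⟨m, rfl⟩ := h
  induction m with
  | zero => exact hu
  | succ m ih => rw [Function.iterate_succ_apply']; exact hS _ ih

/-! ### Unicycles -/

/-- The rotors at the vertices visited by the walk along the rotors from `x`. -/
def RotorConfig.orbitEdges (ϱ : D.RotorConfig) (x : V) : Set E :=
  Set.range fun k => ϱ.1 (ϱ.succ^[k] x)

theorem RotorConfig.orbitEdges_subset (ϱ : D.RotorConfig) (x : V) :
    ϱ.orbitEdges x ⊆ Set.range ϱ.1 := by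
  rintro _ ⟨k, rfl⟩; exact ⟨_, rfl⟩

theorem RotorConfig.eq_of_mem_range (ϱ : D.RotorConfig) {e : E} (he : e ∈ Set.range ϱ.1) :
    ϱ.1 (D.src e) = e := by
  obtain ⟨v, rfl⟩ := he; rw [ϱ.2]

theorem RotorConfig.isDirectedCycle_orbitEdges (ϱ : D.RotorConfig) {x : V}
    (hx : x ∈ Function.periodicPts ϱ.succ) : D.IsDirectedCycle (ϱ.orbitEdges x) := by
  have hpos := Function.minimalPeriod_pos_of_mem_periodicPts hx
  obtain ⟨n, hn⟩ : ∃ n, Function.minimalPeriod ϱ.succ x = n + 1 :=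
    ⟨_, (Nat.succ_pred_eq_of_pos hpos).symm⟩
  refine ⟨n, fun i => ϱ.1 (ϱ.succ^[i.1] x), ?_, ?_, ?_⟩
  · intro i j hij
    simp only [ϱ.2] at hij
    refine Fin.ext (Function.iterate_injOn_Iio_minimalPeriod ?_ ?_ hij) <;>
      simp [hn] <;> omega
  · intro i
    simp only [ϱ.2]
    change ϱ.succ (ϱ.succ^[i.1] x) = _
    rw [← Function.iterate_succ_apply' ϱ.succ]
    rw [← Function.iterate_mod_minimalPeriod_eq (n := i.1.succ), hn, Fin.val_add]
    simp [Nat.succ_eq_add_one, Nat.add_mod]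
  · ext e
    constructor
    · rintro ⟨k, rfl⟩
      refine ⟨⟨k % (n + 1), Nat.mod_lt _ (by omega)⟩, ?_⟩
      simp only
      rw [← hn, Function.iterate_mod_minimalPeriod_eq]
    · rintro ⟨i, rfl⟩
      exact ⟨i.1, rfl⟩

/-- Each vertex has only one rotor, so a cycle made of rotors is forced by any one of its vertices.
-/
theorem RotorConfig.eq_orbitEdges (ϱ : D.RotorConfig) {C : Set E} (hC : D.IsDirectedCycle C)
    (hsub : C ⊆ Set.range ϱ.1) {e : E} (he : e ∈ C) : C = ϱ.orbitEdges (D.src e) := by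
  obtain ⟨n, c, -, hc, rfl⟩ := hC
  obtain ⟨i, rfl⟩ := he
  have hs : ∀ j, ϱ.1 (D.src (c j)) = c j := fun j => ϱ.eq_of_mem_range (hsub ⟨j, rfl⟩)
  have key : ∀ k : ℕ, ϱ.1 (ϱ.succ^[k] (D.src (c i))) = c (i + Fin.ofNat (n + 1) k) := by
    intro k
    induction k with
    | zero => rw [Fin.ofNat_zero, add_zero]; exact hs i
    | succ k ih =>
      have : Fin.ofNat (n + 1) (k + 1) = Fin.ofNat (n + 1) k + 1 := by
        ext; simp [Fin.val_add, Nat.add_mod]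
      rw [Function.iterate_succ_apply', succ, ih, hc, hs, this, add_assoc]
  ext f
  constructor
  · rintro ⟨j, rfl⟩
    refine ⟨(j - i).1, ?_⟩
    simp only [key]
    simp
  · rintro ⟨k, rfl⟩
    exact ⟨_, (key k).symm⟩

theorem RotorConfig.reaches_of_mem_orbitEdges {ϱ : D.RotorConfig} {x : V} {e : E}
    (he : e ∈ ϱ.orbitEdges x) : ϱ.Reaches x (D.src e) := by
  obtain ⟨k, rfl⟩ := he
  exact ⟨k, (ϱ.2 _).symm⟩

/-- In a unicycle, following the rotors leads from every vertex to the chip, and conversely. -/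
theorem isUnicycle_iff [Finite V] (w : V) (ϱ : D.RotorConfig) :
    D.IsUnicycle (w, ϱ) ↔ ∀ v, ϱ.Reaches v w := by
  constructor
  · rintro ⟨C, -, huniq, e, he, rfl⟩ v
    -- By finiteness the walk along the rotors ends in a cycle; uniqueness makes it the cycle
    -- through the chip.
    obtain ⟨m, hm⟩ : ∃ m, ϱ.succ^[m] v ∈ Function.periodicPts ϱ.succ := by
      obtain ⟨i, j, hij, h⟩ := Finite.exists_ne_map_eq_of_infinite fun k : ℕ => ϱ.succ^[k] v
      wlog hlt : i < j generalizing i j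
      · exact this j i hij.symm h.symm (by omega)
      refine ⟨i, j - i, by omega, ?_⟩
      change ϱ.succ^[j - i] (ϱ.succ^[i] v) = _
      rw [← Function.iterate_add_apply, Nat.sub_add_cancel hlt.le]
      exact h.symm
    have hC := huniq _ (ϱ.orbitEdges_subset _) (ϱ.isDirectedCycle_orbitEdges hm)
    obtain ⟨k, hk⟩ := RotorConfig.reaches_of_mem_orbitEdges (hC ▸ he)
    exact ⟨k + m, by rwa [Function.iterate_add_apply]⟩
  · intro h
    obtain ⟨m, hm⟩ := h (ϱ.succ w)
    have hw : w ∈ Function.periodicPts ϱ.succ := ⟨m + 1, by omega, hm⟩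
    refine ⟨ϱ.orbitEdges w, ⟨ϱ.orbitEdges_subset w, ϱ.isDirectedCycle_orbitEdges hw⟩, ?_,
      ϱ.1 w, ⟨0, rfl⟩, ϱ.2 w⟩
    intro C' hsub hcyc
    obtain ⟨e, he⟩ : C'.Nonempty := by
      obtain ⟨n, c, -, -, rfl⟩ := hcyc
      exact Set.range_nonempty c
    obtain ⟨k, hk⟩ := h (D.src e)
    have hmem : ϱ.1 w ∈ C' := by
      rw [ϱ.eq_orbitEdges hcyc hsub he]
      exact ⟨k, congrArg ϱ.1 hk⟩
    rw [ϱ.eq_orbitEdges hcyc hsub hmem, ϱ.2]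

/-! ### Paths and arborescences -/

theorem IsPath.nil (A : Set E) (v : V) : D.IsPath A v v [] := ⟨rfl, by simp⟩

theorem isPath_cons {A : Set E} {u w : V} {e : E} {l : List E} :
    D.IsPath A u w (e :: l) ↔
      e ∈ A ∧ D.src e = u ∧ D.IsPath A (D.tgt e) w l ∧ D.src e ∉ l.map D.src ++ [w] := by
  simp only [IsPath, IsWalk, List.map_cons, List.cons_append, List.nodup_cons]
  tauto

theorem IsPath.exists_prefix {A : Set E} {u w x : V} {l : List E} (h : D.IsPath A u w l)
    (hx : x ∈ l.map D.src ++ [w]) : ∃ l', D.IsPath A u x l' ∧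
      ∀ y ∈ l'.map D.src, y ∈ l.map D.src := by
  induction l generalizing u with
  | nil =>
    obtain rfl : x = w := by simpa using hx
    exact ⟨[], h, by simp⟩
  | cons e l ih =>
    rw [isPath_cons] at h
    obtain ⟨he, rfl, hl, hn⟩ := h
    by_cases hxe : x = D.src e
    · exact ⟨[], hxe ▸ IsPath.nil A _, by simp⟩
    · have hx' : x ∈ l.map D.src ++ [w] := by
        simp only [List.map_cons, List.cons_append, List.mem_cons] at hx
        exact hx.resolve_left hxe
      obtain ⟨l', h', hsub⟩ := ih hl hx'
      refine ⟨e :: l', isPath_cons.2 ⟨he, rfl, h', ?_⟩, ?_⟩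
      · intro hmem
        rw [List.mem_append, List.mem_singleton] at hmem
        rcases hmem with hmem | hmem
        · exact hn (List.mem_append_left _ (hsub _ hmem))
        · exact hxe hmem.symm
      · intro y hy
        simp only [List.map_cons, List.mem_cons] at hy ⊢
        exact hy.imp id (hsub y)

theorem IsWalk.tgt_getElem {A : Set E} {u w : V} {l : List E} (h : D.IsWalk A u w l) (i : ℕ)
    (hi : i < l.length) : D.tgt l[i] = if h' : i + 1 < l.length then D.src l[i + 1] else w := by
  induction l generalizing u i with
  | nil => simp at hi
  | cons e l ih =>
    obtain ⟨-, -, hl⟩ := h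
    cases i with
    | zero =>
      cases l with
      | nil => simpa [IsWalk] using hl
      | cons f l => simpa using hl.2.1.symm
    | succ i =>
      simp only [List.length_cons, List.getElem_cons_succ] at hi ⊢
      rw [ih hl i (by omega)]
      simp

theorem IsWalk.mem {A : Set E} {u w : V} {l : List E} (h : D.IsWalk A u w l) :
    ∀ e ∈ l, e ∈ A := by
  induction l generalizing u with
  | nil => simp
  | cons e l ih =>
    obtain ⟨he, -, hl⟩ := h
    simpa using ⟨he, ih hl⟩

/-- An edge together with a path back from its head to its tail forms a cycle. -/
theorem IsPath.exists_isDirectedCycle {A : Set E} {e : E} {l : List E} (he : e ∈ A)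
    (h : D.IsPath A (D.tgt e) (D.src e) l) : ∃ C ⊆ A, D.IsDirectedCycle C := by
  have hw : D.IsWalk A (D.src e) (D.src e) (e :: l) := ⟨he, rfl, h.1⟩
  refine ⟨Set.range (fun i : Fin (l.length + 1) => (e :: l)[i.1]), ?_,
    l.length, fun i => (e :: l)[i.1], ?_, ?_, rfl⟩
  · rintro _ ⟨i, rfl⟩
    exact hw.mem _ (List.getElem_mem _)
  · have hn : ((e :: l).map D.src).Nodup := by
      rw [List.map_cons, List.nodup_cons]
      have := h.2
      rw [List.nodup_append'] at this
      exact ⟨fun hm => this.2.2 hm (by simp), this.1⟩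
    intro i j hij
    have := (hn.getElem_inj_iff (i := i.1) (hi := by simpa using i.is_le) (j := j.1)
      (hj := by simpa using j.is_le)).1
      (by rw [List.getElem_map, List.getElem_map]; exact hij)
    exact Fin.ext this
  · intro i
    simp only
    rw [hw.tgt_getElem i.1 (by simpa using i.is_le)]
    split_ifs with h'
    · have : (i + 1).1 = i.1 + 1 := by
        rw [Fin.val_add_one_of_lt']; simpa using h'
      simp only [this]
    · have : i = Fin.last _ := by
        apply Fin.ext; have := i.2; simp at h' ⊢; omega
      subst this
      simp

/-- If the tail of `e` already lay on the path, the initial segment up to it would close a cycle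
with `e`. -/
theorem IsPath.cons_of_acyclic {A : Set E} (hA : ∀ C ⊆ A, ¬ D.IsDirectedCycle C) {e : E} {w : V}
    {l : List E} (he : e ∈ A) (h : D.IsPath A (D.tgt e) w l) :
    D.IsPath A (D.src e) w (e :: l) := by
  refine isPath_cons.2 ⟨he, rfl, h, fun hm => ?_⟩
  obtain ⟨l', hl', -⟩ := h.exists_prefix hm
  obtain ⟨C, hCA, hC⟩ := hl'.exists_isDirectedCycle he
  exact hA C hCA hC

theorem RotorConfig.isInArborescence (ϱ : D.RotorConfig) {w : V} (h : ∀ v, ϱ.Reaches v w) :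
    D.IsInArborescence w (ϱ.1 '' {w}ᶜ) := by
  have hmem : ∀ e ∈ ϱ.1 '' {w}ᶜ, ϱ.1 (D.src e) = e ∧ D.src e ≠ w := by
    rintro _ ⟨v, hv, rfl⟩
    rw [ϱ.2]; exact ⟨rfl, hv⟩
  have hacyc : ∀ C ⊆ ϱ.1 '' {w}ᶜ, ¬ D.IsDirectedCycle C := by
    rintro _ hC ⟨n, c, -, hc, rfl⟩
    -- The vertices of a cycle are closed under the rotors, hence contain `w`, but no edge of the
    -- set leaves `w`.
    have := (h (D.src (c 0))).mem_of_closed (S := Set.range fun i => D.src (c i))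
      (by
        rintro _ ⟨i, rfl⟩
        refine ⟨i + 1, ?_⟩
        simp only [succ]
        rw [(hmem _ (hC ⟨i, rfl⟩)).1, hc]) ⟨0, rfl⟩
    obtain ⟨i, hi⟩ := this
    exact (hmem _ (hC ⟨i, rfl⟩)).2 hi
  refine ⟨hacyc, fun v hv => ?_⟩
  clear hv
  obtain ⟨l, hl⟩ : ∃ l, D.IsPath (ϱ.1 '' {w}ᶜ) v w l := by
    refine (h v).induction_on (P := fun v => ∃ l, D.IsPath (ϱ.1 '' {w}ᶜ) v w l)
      ⟨[], IsPath.nil _ _⟩ ?_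
    rintro u hu ⟨l, hl⟩
    refine ⟨ϱ.1 u :: l, ?_⟩
    have := IsPath.cons_of_acyclic hacyc (e := ϱ.1 u) ⟨u, hu, rfl⟩ hl
    rwa [ϱ.2] at this
  refine ⟨l, hl, fun l' hl' => ?_⟩
  have hl1 := hl.1
  have hl2 := hl'.1
  clear hl hl'
  induction l' generalizing v l with
  | nil =>
    obtain rfl : v = w := hl2
    cases l with
    | nil => rfl
    | cons e l => exact absurd hl1.2.1 (hmem e hl1.1).2
  | cons e l' ih =>
    obtain ⟨he, rfl, hl2⟩ := hl2
    cases l with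
    | nil => exact absurd hl1 (hmem e he).2
    | cons f l =>
      obtain ⟨hf, hfe, hl1⟩ := hl1
      obtain rfl : e = f := by rw [← (hmem e he).1, ← hfe, (hmem f hf).1]
      rw [ih (D.tgt e) l hl1 hl2]

/-- The rotor at `v ≠ w` is the first edge of the unique path to `w`. Every edge of `A` arises so:
prefixed to a path from its head, it gives a path to `w`. -/
theorem IsInArborescence.exists_rotorConfig {w : V} {A : Set E} (hA : D.IsInArborescence w A)
    {e₀ : E} (he₀ : D.src e₀ = w) :
    ∃ ϱ : D.RotorConfig, (∀ v, ϱ.Reaches v w) ∧ ϱ.1 w = e₀ ∧ ϱ.1 '' {w}ᶜ = A := by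
  classical
  obtain ⟨hacyc, hA⟩ := hA
  have : Nonempty E := ⟨e₀⟩
  have hroot : ∀ e ∈ A, D.src e ≠ w := by
    intro e he hew
    obtain ⟨l, hl⟩ : ∃ l, D.IsPath A (D.tgt e) (D.src e) l := by
      by_cases ht : D.tgt e = w
      · exact ⟨[], by rw [ht, hew]; exact IsPath.nil _ _⟩
      · rw [hew]; exact (hA _ ht).exists
    obtain ⟨C, hCA, hC⟩ := hl.exists_isDirectedCycle he
    exact hacyc C hCA hC
  have hex : ∀ v, v ≠ w → ∃ e l, D.IsPath A v w (e :: l) := by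
    intro v hv
    obtain ⟨l, hl⟩ := (hA v hv).exists
    cases l with
    | nil => exact absurd hl.1 hv
    | cons e l => exact ⟨e, l, hl⟩
  choose! g l hg using hex
  have hgA : ∀ v, v ≠ w → g v ∈ A := fun v hv => (isPath_cons.1 (hg v hv)).1
  have hgs : ∀ v, v ≠ w → D.src (g v) = v := fun v hv => (isPath_cons.1 (hg v hv)).2.1
  have hhead : ∀ v e l', v ≠ w → D.IsPath A v w (e :: l') → g v = e := by
    intro v e l' hv hp
    exact (List.cons.inj ((hA v hv).unique (hg v hv) hp)).1
  let ϱ : D.RotorConfig := ⟨fun v => if v = w then e₀ else g v, fun v => by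
    dsimp only
    split_ifs with h
    · rw [he₀, h]
    · exact hgs v h⟩
  have hϱ : ∀ v, v ≠ w → ϱ.1 v = g v := fun v hv => if_neg hv
  have hreach : ∀ l' v, D.IsPath A v w l' → ϱ.Reaches v w := by
    intro l'
    induction l' with
    | nil => intro v hv; exact ⟨0, hv.1⟩
    | cons e l' ih =>
      intro v hp
      obtain ⟨he, hsrc, ht, hn⟩ := isPath_cons.1 hp
      have hv : v ≠ w := fun h => hroot e he (hsrc.trans h)
      apply RotorConfig.Reaches.head
      rw [RotorConfig.succ, hϱ v hv, hhead v e l' hv hp]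
      exact ih _ ht
  refine ⟨ϱ, fun v => ?_, if_pos rfl, ?_⟩
  · by_cases hv : v = w
    · exact ⟨0, hv⟩
    · exact hreach _ _ (hg v hv)
  · ext e
    constructor
    · rintro ⟨v, hv, rfl⟩
      rw [hϱ v hv]; exact hgA v hv
    · intro he
      refine ⟨D.src e, hroot e he, ?_⟩
      rw [hϱ _ (hroot e he)]
      obtain ⟨l', hl'⟩ : ∃ l', D.IsPath A (D.tgt e) w l' := by
        by_cases ht : D.tgt e = w
        · exact ⟨[], by rw [ht]; exact IsPath.nil _ _⟩
        · exact (hA _ ht).exists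
      exact hhead _ _ l' (hroot e he) (hl'.cons_of_acyclic hacyc he)

instance [Finite V] [Finite E] : Finite D.RotorConfig := by
  unfold RotorConfig; infer_instance

/-- Unicycles with the chip at `w` correspond to pairs of an out-edge of `w` and an arborescence
rooted at `w`. -/
theorem card_isUnicycle [Finite V] (w : V) :
    Nat.card {ϱ : D.RotorConfig // D.IsUnicycle (w, ϱ)} =
      D.outDeg w * D.numInArborescences w := by
  rw [outDeg, numInArborescences, ← Nat.card_coe_set_eq, ← Nat.card_prod]
  refine Nat.card_congr (Equiv.ofBijective (fun ϱ => (⟨ϱ.1.1 w, ϱ.1.2 w⟩, ⟨ϱ.1.1 '' {w}ᶜ,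
    ϱ.1.isInArborescence ((isUnicycle_iff w ϱ.1).1 ϱ.2)⟩)) ⟨?_, ?_⟩)
  · rintro ⟨ϱ, hϱ⟩ ⟨σ, hσ⟩ h
    simp only [Prod.mk.injEq, Subtype.mk.injEq] at h
    refine Subtype.ext (Subtype.ext (funext fun v => ?_))
    by_cases hv : v = w
    · rw [hv]; exact h.1
    · obtain ⟨u, -, hu⟩ : ϱ.1 v ∈ σ.1 '' {w}ᶜ := h.2 ▸ ⟨v, hv, rfl⟩
      have : u = v := by rw [← σ.2 u, hu, ϱ.2]
      change ϱ.1 v = σ.1 v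
      rw [← hu, this]
  · rintro ⟨⟨e₀, he₀⟩, A, hA⟩
    obtain ⟨ϱ, h1, rfl, rfl⟩ := IsInArborescence.exists_rotorConfig hA he₀
    exact ⟨⟨ϱ, (isUnicycle_iff w ϱ).2 h1⟩, rfl⟩

/-! ### Rotating and the resulting flow of chips -/

namespace RotorOrder

variable (r : D.RotorOrder)

theorem src_iterate_next (e : E) (n : ℕ) : D.src (r.next^[n] e) = D.src e := by
  induction n with
  | zero => rfl
  | succ n ih => rw [Function.iterate_succ_apply', r.src_next, ih]

theorem exists_iterate_next [Finite E] {e f : E} (h : D.src e = D.src f) :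
    ∃ n : ℕ, r.next^[n] e = f := by
  obtain ⟨n, hn⟩ := ((r.sameCycle_iff e f).2 h).exists_nat_pow_eq
  exact ⟨n, by rwa [Equiv.Perm.iterate_eq_pow]⟩

/-- Advance the rotor at each vertex `v` by `z v` steps. -/
def rotate (z : V → ℕ) (ϱ : D.RotorConfig) : D.RotorConfig :=
  ⟨fun v => r.next^[z v] (ϱ.1 v), fun v => by rw [r.src_iterate_next, ϱ.2]⟩

theorem rotate_add (z z' : V → ℕ) (ϱ : D.RotorConfig) :
    r.rotate (z + z') ϱ = r.rotate z' (r.rotate z ϱ) := by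
  refine Subtype.ext (funext fun v => ?_)
  simp only [rotate, Pi.add_apply]
  rw [add_comm, Function.iterate_add_apply]

@[simp]
theorem rotate_zero (ϱ : D.RotorConfig) : r.rotate 0 ϱ = ϱ := rfl

theorem exists_rotate_eq [Finite E] (ϱ σ : D.RotorConfig) : ∃ z, r.rotate z ϱ = σ := by
  have (v : V) : ∃ n : ℕ, r.next^[n] (ϱ.1 v) = σ.1 v :=
    r.exists_iterate_next ((ϱ.2 v).trans (σ.2 v).symm)
  choose z hz using this
  exact ⟨z, Subtype.ext (funext hz)⟩

/-- A full turn of a rotor uses every out-edge once. The exponent is `k + 1` because the rotor is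
advanced before a chip is sent. -/
theorem sum_range_minimalPeriod [Fintype E] [DecidableEq V] {M : Type*} [AddCommMonoid M]
    (g : E → M) (e : E) :
    ∑ k ∈ Finset.range (Function.minimalPeriod r.next e), g (r.next^[k + 1] e) =
      ∑ f with D.src f = D.src e, g f := by
  have hper : e ∈ Function.periodicPts r.next := r.next.injective.mem_periodicPts e
  have hpos := Function.minimalPeriod_pos_of_mem_periodicPts hper
  refine Finset.sum_bij (fun k _ => r.next^[k + 1] e) ?_ ?_ ?_ (fun _ _ => rfl)
  · intro k _
    simp [r.src_iterate_next, -Function.iterate_succ]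
  · intro i hi j hj hij
    simp only [Function.iterate_succ_apply'] at hij
    exact Function.iterate_injOn_Iio_minimalPeriod (by simpa using hi) (by simpa using hj)
      (r.next.injective hij)
  · intro f hf
    obtain ⟨n, hn⟩ := r.exists_iterate_next (e := r.next e) (f := f)
      (by rw [r.src_next]; exact (Finset.mem_filter.1 hf).2.symm)
    refine ⟨n % Function.minimalPeriod r.next e, by simpa using Nat.mod_lt _ hpos, ?_⟩
    rw [Function.iterate_succ_apply', Function.iterate_mod_minimalPeriod_eq,
      ← Function.iterate_succ_apply' r.next, Function.iterate_succ_apply, hn]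

theorem minimalPeriod_next [Finite E] (e : E) :
    Function.minimalPeriod r.next e = D.outDeg (D.src e) := by
  classical
  have := Fintype.ofFinite E
  have := r.sum_range_minimalPeriod (fun _ => 1) e
  rw [outDeg, Nat.card_eq_fintype_card, Fintype.card_subtype]
  simpa using this

theorem iterate_next_outDeg [Finite E] (e : E) (q : ℕ) :
    r.next^[D.outDeg (D.src e) * q] e = e := by
  rw [← r.minimalPeriod_next]
  exact (Function.isPeriodicPt_minimalPeriod _ _).mul_const q

theorem rotate_outDeg_mul [Finite E] (q : V → ℕ) (ϱ : D.RotorConfig) :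
    r.rotate (fun v => D.outDeg v * q v) ϱ = ϱ := by
  refine Subtype.ext (funext fun v => ?_)
  change r.next^[D.outDeg v * q v] (ϱ.1 v) = ϱ.1 v
  have := r.iterate_next_outDeg (ϱ.1 v) (q v)
  rwa [ϱ.2 v] at this

theorem exists_eq_outDeg_mul [Finite E] {z : V → ℕ} {ϱ : D.RotorConfig} (h : r.rotate z ϱ = ϱ) :
    ∃ q : V → ℕ, z = fun v => D.outDeg v * q v := by
  have (v : V) : D.outDeg v ∣ z v := by
    rw [← ϱ.2 v, ← r.minimalPeriod_next, ϱ.2 v]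
    exact Function.IsPeriodicPt.minimalPeriod_dvd (congrFun (congrArg Subtype.val h) v)
  choose q hq using this
  exact ⟨q, funext hq⟩

variable [DecidableEq V]

/-- The change of the chip configuration when `n` chips are sent from the tail of `e` along the
edges that follow `e`. -/
def edgeFlow (e : E) (n : ℕ) : V → ℤ :=
  ∑ k ∈ Finset.range n, (Pi.single (D.tgt (r.next^[k + 1] e)) 1 - Pi.single (D.src e) 1)

theorem edgeFlow_add (e : E) (m n : ℕ) :
    r.edgeFlow e (m + n) = r.edgeFlow e m + r.edgeFlow (r.next^[m] e) n := by
  rw [edgeFlow, Finset.sum_range_add]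
  congr 1
  refine Finset.sum_congr rfl fun k _ => ?_
  rw [r.src_iterate_next, ← Function.iterate_add_apply]
  congr 4
  ring

theorem sum_edgeFlow [Fintype V] (e : E) (n : ℕ) : ∑ v, r.edgeFlow e n v = 0 := by
  simp only [edgeFlow, Finset.sum_apply]
  rw [Finset.sum_comm]
  simp

/-- A full turn of one rotor fires its vertex, which adds a column of the Laplacian. -/
theorem edgeFlow_outDeg [Fintype V] [Finite E] (e : E) :
    r.edgeFlow e (D.outDeg (D.src e)) = D.laplacian.mulVec (Pi.single (D.src e) 1) := by
  have := Fintype.ofFinite E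
  rw [edgeFlow, Finset.sum_sub_distrib, ← r.minimalPeriod_next,
    r.sum_range_minimalPeriod (fun f => (Pi.single (D.tgt f) 1 : V → ℤ)), r.minimalPeriod_next]
  ext i
  have h : (∑ f with D.src f = D.src e, (Pi.single (D.tgt f) 1 : V → ℤ)) i =
      D.mult (D.src e) i := by
    rw [mult, Nat.card_eq_fintype_card, Fintype.card_subtype, Finset.sum_apply,
      ← Finset.filter_filter, Finset.card_filter]
    push_cast
    refine Finset.sum_congr rfl fun f _ => ?_
    simp [Pi.single_apply, eq_comm]
  rw [Pi.sub_apply, h, Matrix.mulVec_single_one]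
  by_cases hi : i = D.src e
  · subst hi; simp [laplacian]
  · simp [laplacian, hi]

theorem edgeFlow_outDeg_mul [Fintype V] [Finite E] (e : E) (q : ℕ) :
    r.edgeFlow e (D.outDeg (D.src e) * q) =
      D.laplacian.mulVec (Pi.single (D.src e) (q : ℤ)) := by
  induction q with
  | zero => simp [edgeFlow]
  | succ q ih =>
    rw [mul_add, mul_one, edgeFlow_add, ih, iterate_next_outDeg, edgeFlow_outDeg,
      ← Matrix.mulVec_add, ← Pi.single_add]
    norm_cast

/-- The change of the chip configuration when every vertex `v` sends `z v` chips. -/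
def flow [Fintype V] (z : V → ℕ) (ϱ : D.RotorConfig) : V → ℤ := ∑ v, r.edgeFlow (ϱ.1 v) (z v)

/-- Cocycle identity: the second batch of chips starts from the rotors left by the first. -/
theorem flow_add [Fintype V] (z z' : V → ℕ) (ϱ : D.RotorConfig) :
    r.flow (z + z') ϱ = r.flow z ϱ + r.flow z' (r.rotate z ϱ) := by
  simp only [flow, Pi.add_apply, edgeFlow_add, Finset.sum_add_distrib]
  rfl

@[simp]
theorem flow_zero [Fintype V] (ϱ : D.RotorConfig) : r.flow 0 ϱ = 0 := by
  simp [flow, edgeFlow]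

theorem flow_outDeg_mul [Fintype V] [Finite E] (q : V → ℕ) (ϱ : D.RotorConfig) :
    r.flow (fun v => D.outDeg v * q v) ϱ = D.laplacian.mulVec (fun v => (q v : ℤ)) := by
  have h (v : V) : r.edgeFlow (ϱ.1 v) (D.outDeg v * q v) =
      D.laplacian.mulVec (Pi.single v (q v : ℤ)) := by
    have := r.edgeFlow_outDeg_mul (ϱ.1 v) (q v)
    rwa [ϱ.2] at this
  simp only [flow, h]
  rw [← Matrix.mulVec_sum, Finset.univ_sum_single]

theorem rotate_single (w : V) (ϱ : D.RotorConfig) :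
    r.rotate (Pi.single w 1) ϱ = r.advance w ϱ := by
  refine Subtype.ext (funext fun v => ?_)
  by_cases h : v = w
  · subst h; simp [rotate, advance]
  · simp [rotate, advance, h]

theorem flow_single [Fintype V] (w : V) (ϱ : D.RotorConfig) :
    r.flow (Pi.single w 1) ϱ = Pi.single (r.step (w, ϱ)).1 1 - Pi.single w 1 := by
  rw [flow, Finset.sum_eq_single w]
  · simp [edgeFlow, ϱ.2, step, advance]
  · intro v _ hv
    simp [edgeFlow, hv]
  · simp

/-! ### The rotor walk -/

/-- The number of times that the chip leaves `v` in the first `k` steps from `c`. -/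
def visits (c : D.ChipRotorConfig) (k : ℕ) : V → ℕ :=
  ∑ i ∈ Finset.range k, Pi.single (r.step^[i] c).1 1

theorem visits_add (c : D.ChipRotorConfig) (k l : ℕ) :
    r.visits c (k + l) = r.visits c k + r.visits (r.step^[k] c) l := by
  rw [visits, Finset.sum_range_add]
  congr 1
  refine Finset.sum_congr rfl fun i _ => ?_
  rw [← Function.iterate_add_apply, add_comm i]

theorem visits_one (c : D.ChipRotorConfig) : r.visits c 1 = Pi.single c.1 1 := by
  simp [visits]

theorem sum_visits [Fintype V] (c : D.ChipRotorConfig) (k : ℕ) : ∑ v, r.visits c k v = k := by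
  simp only [visits, Finset.sum_apply]
  rw [Finset.sum_comm]
  simp

theorem visits_apply (c : D.ChipRotorConfig) (k : ℕ) (v : V) :
    r.visits c k v = ((Finset.range k).filter fun i => (r.step^[i] c).1 = v).card := by
  simp only [visits, Finset.sum_apply, Pi.single_apply, Finset.card_filter]
  exact Finset.sum_congr rfl fun i _ => by simp [eq_comm]

theorem step_snd (c : D.ChipRotorConfig) : (r.step c).2 = r.rotate (Pi.single c.1 1) c.2 :=
  (r.rotate_single c.1 c.2).symm

theorem iterate_step_snd (c : D.ChipRotorConfig) (k : ℕ) :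
    (r.step^[k] c).2 = r.rotate (r.visits c k) c.2 := by
  induction k with
  | zero => simp [visits]
  | succ k ih =>
    rw [visits_add, visits_one, rotate_add, ← ih, Function.iterate_succ_apply', step_snd]

/-- Together with `iterate_step_snd`, this reduces the walk to its visit counts, so that the order
of the steps no longer matters. -/
theorem single_iterate_step_fst [Fintype V] (c : D.ChipRotorConfig) (k : ℕ) :
    (Pi.single (r.step^[k] c).1 1 : V → ℤ) = Pi.single c.1 1 + r.flow (r.visits c k) c.2 := by
  induction k with
  | zero => simp [visits]
  | succ k ih =>
    rw [visits_add, visits_one, flow_add, ← add_assoc, ← ih, ← iterate_step_snd, flow_single,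
      Function.iterate_succ_apply']
    simp

/-! ### The rotor walk passes through unicycles -/

theorem succ_step_of_ne (c : D.ChipRotorConfig) {v : V} (hv : v ≠ c.1) :
    (r.step c).2.succ v = c.2.succ v := by
  simp [RotorConfig.succ, step, advance, hv]

/-- Only the rotor at the old chip position changes, and it then points to the new one. -/
theorem reaches_step {c : D.ChipRotorConfig} {v : V} (h : c.2.Reaches v c.1) :
    (r.step c).2.Reaches v (r.step c).1 := by
  refine h.induction_on (P := fun v => (r.step c).2.Reaches v (r.step c).1) ?_ ?_
  · exact (RotorConfig.Reaches.refl _ _).head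
  · intro u hu h
    rw [← r.succ_step_of_ne c hu] at h
    exact h.head

theorem isUnicycle_step [Finite V] {c : D.ChipRotorConfig} (h : D.IsUnicycle c) :
    D.IsUnicycle (r.step c) :=
  (isUnicycle_iff _ _).2 fun v => r.reaches_step ((isUnicycle_iff c.1 c.2).1 h v)

theorem isUnicycle_iterate_step [Finite V] {c : D.ChipRotorConfig} (h : D.IsUnicycle c) (k : ℕ) :
    D.IsUnicycle (r.step^[k] c) := by
  induction k with
  | zero => exact h
  | succ k ih => rw [Function.iterate_succ_apply']; exact r.isUnicycle_step ih

/-- The rotor at a visited vertex records the last exit; following last exits leads to the chip. -/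
theorem reaches_of_visits_pos {c : D.ChipRotorConfig} {k : ℕ} {v : V}
    (h : 0 < r.visits c k v) : (r.step^[k] c).2.Reaches v (r.step^[k] c).1 := by
  induction k with
  | zero => simp [visits] at h
  | succ k ih =>
    rw [Function.iterate_succ_apply']
    by_cases hv : v = (r.step^[k] c).1
    · rw [hv]; exact r.reaches_step (RotorConfig.Reaches.refl _ _)
    · refine r.reaches_step (ih ?_)
      rw [visits_add, visits_one] at h
      simpa [hv] using h

theorem isUnicycle_of_visits_pos [Finite V] {c : D.ChipRotorConfig} {k : ℕ}
    (h : ∀ v, 0 < r.visits c k v) : D.IsUnicycle (r.step^[k] c) :=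
  (isUnicycle_iff _ _).2 fun v => r.reaches_of_visits_pos (h v)

/-- Rotations that take a chip configuration to a unicycle can only be empty unless they involve
the vertex of the chip. -/
theorem eq_zero_of_flow_eq [Fintype V] {w w' : V} {ϱ : D.RotorConfig} {z : V → ℕ}
    (hflow : Pi.single w 1 + r.flow z ϱ = Pi.single w' 1)
    (huni : D.IsUnicycle (w', r.rotate z ϱ)) (hw : z w = 0) : z = 0 := by
  classical
  by_contra hz
  obtain ⟨u, hu⟩ : ∃ u, z u ≠ 0 := by
    by_contra! h
    exact hz (funext h)
  -- `χ` is the indicator of the support of `z`. The initial chip lies outside the support and all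
  -- chips are sent from inside it, so the number of chips inside cannot increase.
  let χ : V → ℤ := fun v => if z v = 0 then 0 else 1
  have hχ : ∀ v, χ v ≤ 1 := fun v => by dsimp only [χ]; split_ifs <;> simp
  have hterm : ∀ v, ∀ k ∈ Finset.range (z v), χ (D.tgt (r.next^[k + 1] (ϱ.1 v))) - χ v ≤ 0 := by
    intro v k hk
    have hv : χ v = 1 := if_neg (by have := Finset.mem_range.1 hk; omega)
    rw [hv]
    linarith [hχ (D.tgt (r.next^[k + 1] (ϱ.1 v)))]
  have hsum : χ w' = ∑ v, ∑ k ∈ Finset.range (z v),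
      (χ (D.tgt (r.next^[k + 1] (ϱ.1 v))) - χ v) := by
    have h := congrArg (fun x => χ ⬝ᵥ x) hflow
    simp only [dotProduct_add, flow, edgeFlow, dotProduct_sum, dotProduct_sub,
      dotProduct_single_one, ϱ.2] at h
    rw [← h]
    simp [χ, hw]
  have hw'0 : 0 ≤ χ w' := by dsimp only [χ]; split_ifs <;> simp
  have hle : ∀ v ∈ Finset.univ, ∑ k ∈ Finset.range (z v),
      (χ (D.tgt (r.next^[k + 1] (ϱ.1 v))) - χ v) ≤ 0 :=
    fun v _ => Finset.sum_nonpos (hterm v)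
  have htot := le_antisymm (Finset.sum_nonpos hle) (hsum ▸ hw'0)
  have hall := (Finset.sum_eq_zero_iff_of_nonpos hle).1 htot
  -- No chip leaves the support. The last chip sent from `v`, with index `z v - 1`, follows the
  -- final rotor, so the support is closed under the final rotors and must contain `w'`.
  have hclosed : ∀ v ∈ {v | z v ≠ 0}, (r.rotate z ϱ).succ v ∈ {v | z v ≠ 0} := by
    intro v hv
    have hv' : z v ≠ 0 := hv
    have h := (Finset.sum_eq_zero_iff_of_nonpos (hterm v)).1 (hall v (Finset.mem_univ v))
      (z v - 1) (by simp; omega)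
    have h1 : χ v = 1 := if_neg hv'
    rw [h1, Nat.sub_add_cancel (by omega)] at h
    intro h0
    have : χ (D.tgt (r.next^[z v] (ϱ.1 v))) = 0 := if_pos h0
    omega
  have hmem := ((isUnicycle_iff _ _).1 huni u).mem_of_closed hclosed hu
  have : χ w' = 1 := if_neg hmem
  omega

/-- If rotations take a chip configuration to a unicycle, then so does the rotor walk, with the
same number of visits to each vertex. -/
theorem iterate_step_of_flow_eq [Fintype V] {w w' : V} {ϱ : D.RotorConfig} {z : V → ℕ}
    (hflow : Pi.single w 1 + r.flow z ϱ = Pi.single w' 1)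
    (huni : D.IsUnicycle (w', r.rotate z ϱ)) :
    r.step^[∑ v, z v] (w, ϱ) = (w', r.rotate z ϱ) ∧ r.visits (w, ϱ) (∑ v, z v) = z := by
  obtain ⟨n, hn⟩ : ∃ n, ∑ v, z v = n := ⟨_, rfl⟩
  rw [hn]
  have h0 : ∀ (w : V) (ϱ : D.RotorConfig) (z : V → ℕ),
      Pi.single w 1 + r.flow z ϱ = Pi.single w' 1 → z = 0 → w = w' := by
    rintro w ϱ z h rfl
    rw [flow_zero, add_zero] at h
    have := congrFun h w
    by_contra hne
    simp [hne] at this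
  induction n generalizing w ϱ z with
  | zero =>
    have hz : z = 0 := funext fun v => Finset.sum_eq_zero_iff.1 hn v (Finset.mem_univ v)
    have := h0 w ϱ z hflow hz
    subst hz this
    simp [visits]
  | succ n ih =>
    have hw : z w ≠ 0 := by
      intro hw
      have := r.eq_zero_of_flow_eq hflow huni hw
      simp [this] at hn
    -- Since `z w ≠ 0`, one rotation at `w` can be split off; it is the first step of the walk.
    obtain ⟨z', rfl⟩ : ∃ z' : V → ℕ, z = (Pi.single w 1 : V → ℕ) + z' := by
      refine ⟨z - Pi.single w 1, funext fun v => ?_⟩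
      by_cases hv : v = w
      · subst hv
        simp only [Pi.add_apply, Pi.sub_apply, Pi.single_eq_same]
        omega
      · simp only [Pi.add_apply, Pi.sub_apply, Pi.single_eq_of_ne hv]
        omega
    rw [flow_add, flow_single, ← add_assoc, add_sub_cancel] at hflow
    rw [rotate_add] at huni ⊢
    have hn' : ∑ v, z' v = n := by
      simp [Finset.sum_add_distrib] at hn
      omega
    have hstep : r.step (w, ϱ) = ((r.step (w, ϱ)).1, r.rotate (Pi.single w 1) ϱ) :=
      Prod.ext rfl (r.step_snd (w, ϱ))
    obtain ⟨h1, h2⟩ := ih hflow huni hn'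
    rw [← hstep] at h1 h2
    refine ⟨by rw [Function.iterate_succ_apply, h1], ?_⟩
    rw [add_comm n 1, visits_add, visits_one, Function.iterate_one, h2]

end RotorOrder

end MultiDigraph

namespace MultiDigraph

variable {V E : Type*} {D : MultiDigraph V E}

/-! ### Consequences of strong connectivity -/

theorem StronglyConnected.exists_src_eq [Nonempty E] (hD : D.StronglyConnected) (v : V) :
    ∃ e, D.src e = v := by
  obtain ⟨e⟩ := ‹Nonempty E›
  rcases (hD v (D.src e)).cases_head with h | ⟨_, ⟨f, hf, -⟩, -⟩
  · exact ⟨e, h.symm⟩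
  · exact ⟨f, hf⟩

theorem StronglyConnected.nonempty_rotorConfig [Nonempty E] (hD : D.StronglyConnected) :
    Nonempty D.RotorConfig := by
  choose g hg using hD.exists_src_eq
  exact ⟨⟨g, hg⟩⟩

theorem StronglyConnected.outDeg_pos [Finite E] [Nonempty E] (hD : D.StronglyConnected) (v : V) :
    0 < D.outDeg v := by
  obtain ⟨e, he⟩ := hD.exists_src_eq v
  have : Nonempty {e : E // D.src e = v} := ⟨⟨e, he⟩⟩
  exact Nat.card_pos

theorem mult_pos [Finite E] (e : E) : 0 < D.mult (D.src e) (D.tgt e) := by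
  have : Nonempty {f : E // D.src f = D.src e ∧ D.tgt f = D.tgt e} := ⟨⟨e, rfl, rfl⟩⟩
  exact Nat.card_pos

variable [Fintype V] [DecidableEq V]

/-! ### The kernel of the Laplacian -/

theorem laplacian_mulVec_apply (q : V → ℤ) (i : V) :
    D.laplacian.mulVec q i = ∑ j, (D.mult j i : ℤ) * q j - D.outDeg i * q i := by
  have h (j : V) : D.laplacian i j * q j =
      (D.mult j i : ℤ) * q j - if j = i then (D.outDeg i : ℤ) * q i else 0 := by
    by_cases hij : i = j
    · subst hij; simp [laplacian]; ring
    · simp [laplacian, hij, Ne.symm hij]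
  simp [Matrix.mulVec, dotProduct, h, Finset.sum_sub_distrib]

/-- A nonnegative vector in the kernel of the Laplacian is zero if one of its entries is. -/
theorem StronglyConnected.eq_zero_of_apply_eq_zero [Finite E] (hD : D.StronglyConnected)
    {q : V → ℤ} (hq : D.laplacian.mulVec q = 0) (hnn : ∀ v, 0 ≤ q v) {w : V} (hw : q w = 0) :
    q = 0 := by
  funext v
  induction hD v w using Relation.ReflTransGen.head_induction_on with
  | refl => exact hw
  | head h _ ih =>
    obtain ⟨e, rfl, rfl⟩ := h
    rw [Pi.zero_apply] at ih ⊢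
    -- Zeros spread backwards along edges: at the head of `e` the kernel equation is a vanishing sum
    -- of nonnegative terms.
    have h := laplacian_mulVec_apply (D := D) q (D.tgt e)
    rw [hq, ih, Pi.zero_apply, mul_zero, sub_zero] at h
    have := (Finset.sum_eq_zero_iff_of_nonneg
      (fun j _ => mul_nonneg (Int.natCast_nonneg _) (hnn j))).1 h.symm (D.src e)
      (Finset.mem_univ _)
    have hm := mult_pos (D := D) e
    rcases mul_eq_zero.1 this with h | h
    · omega
    · exact h

theorem StronglyConnected.pos_of_ne_zero [Finite E] (hD : D.StronglyConnected)
    {q : V → ℤ} (hq : D.laplacian.mulVec q = 0) (hnn : ∀ v, 0 ≤ q v) (h0 : q ≠ 0) (v : V) :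
    0 < q v :=
  (hnn v).lt_of_ne fun h => h0 (hD.eq_zero_of_apply_eq_zero hq hnn h.symm)

theorem StronglyConnected.mul_apply_eq [Finite E] (hD : D.StronglyConnected) {p q : V → ℤ}
    (hp : D.laplacian.mulVec p = 0) (hpos : ∀ v, 0 < p v) (hq : D.laplacian.mulVec q = 0)
    (u v : V) : p u * q v = q u * p v := by
  -- compare with the vertex that minimizes the quotient of the entries
  obtain ⟨w, -, hw⟩ := Finset.exists_min_image Finset.univ (fun v => (q v : ℚ) / p v)
    ⟨u, Finset.mem_univ u⟩
  have hker : D.laplacian.mulVec (p w • q - q w • p) = 0 := by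
    rw [Matrix.mulVec_sub, Matrix.mulVec_smul, Matrix.mulVec_smul, hp, hq]; simp
  have hz := hD.eq_zero_of_apply_eq_zero hker (w := w) (fun v => by
    have h := hw v (Finset.mem_univ v)
    rw [div_le_div_iff₀ (by exact_mod_cast hpos w) (by exact_mod_cast hpos v)] at h
    have h' : q w * p v ≤ q v * p w := by exact_mod_cast h
    simp only [Pi.sub_apply, Pi.smul_apply, smul_eq_mul]
    linarith) (by simp [mul_comm])
  have hrow (v : V) : p w * q v = q w * p v := by
    have := congrFun hz v
    simp only [Pi.sub_apply, Pi.smul_apply, smul_eq_mul, Pi.zero_apply] at this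
    linarith
  apply mul_left_cancel₀ (hpos w).ne'
  linear_combination p u * hrow v - p v * hrow u

theorem IsPeriodVector.ne_zero {p : V → ℤ} (hp : D.IsPeriodVector p) : p ≠ 0 := by
  rintro rfl
  exact absurd (hp.primitive 0 (by simp)) (by simp)

theorem IsPeriodVector.pos [Finite E] (hD : D.StronglyConnected) {p : V → ℤ}
    (hp : D.IsPeriodVector p) (v : V) : 0 < p v :=
  hD.pos_of_ne_zero hp.laplacian_mulVec hp.nonneg hp.ne_zero v

/-- The kernel of the Laplacian is generated by the period vector. -/
theorem IsPeriodVector.exists_eq_smul [Finite E] (hD : D.StronglyConnected) {p q : V → ℤ}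
    (hp : D.IsPeriodVector p) (hq : D.laplacian.mulVec q = 0) : ∃ t : ℤ, q = t • p := by
  obtain ⟨d, hd⟩ := IsPrincipalIdealRing.principal (Ideal.span (Set.range p))
  have hdu : IsUnit d := hp.primitive d fun v => by
    rw [← Ideal.mem_span_singleton]
    change p v ∈ Submodule.span ℤ {d}
    rw [← hd]
    exact Ideal.subset_span ⟨v, rfl⟩
  have h1 : (1 : ℤ) ∈ Ideal.span (Set.range p) := by
    rw [hd]
    change (1 : ℤ) ∈ Ideal.span {d}
    rw [Ideal.mem_span_singleton]
    exact hdu.dvd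
  -- The Bézout coefficients of `p`, applied to `q`, give the multiplier `t`.
  obtain ⟨c, hc⟩ := Ideal.mem_span_range_iff_exists_fun.1 h1
  refine ⟨∑ u, c u * q u, funext fun v => ?_⟩
  simp only [Pi.smul_apply, smul_eq_mul, Finset.sum_mul]
  calc q v = (∑ u, c u * p u) * q v := by rw [hc, one_mul]
    _ = ∑ u, c u * q u * p v := by
      rw [Finset.sum_mul]
      refine Finset.sum_congr rfl fun u _ => ?_
      rw [mul_assoc, hD.mul_apply_eq hp.laplacian_mulVec (hp.pos hD) hq u v, mul_assoc]

theorem IsPeriodVector.unique [Finite E] (hD : D.StronglyConnected) {p q : V → ℤ}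
    (hp : D.IsPeriodVector p) (hq : D.IsPeriodVector q) : q = p := by
  obtain ⟨t, rfl⟩ := hp.exists_eq_smul hD hq.laplacian_mulVec
  have ht : IsUnit t := hq.primitive t fun v => ⟨p v, rfl⟩
  rcases Int.isUnit_iff.1 ht with rfl | rfl
  · simp
  · obtain ⟨v, -⟩ := Function.ne_iff.1 hp.ne_zero
    have h1 := hp.pos hD v
    have h2 := hq.pos hD v
    simp at h2
    omega

theorem exists_isPeriodVector {q : V → ℤ} (hq : D.laplacian.mulVec q = 0)
    (hnn : ∀ v, 0 ≤ q v) (h0 : q ≠ 0) : ∃ p : V → ℤ, D.IsPeriodVector p := by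
  obtain ⟨v₀, hv₀⟩ := Function.ne_iff.1 h0
  obtain ⟨p, hqp, hgcd⟩ := Finset.extract_gcd q (s := Finset.univ) ⟨v₀, Finset.mem_univ v₀⟩
  set g := Finset.univ.gcd q
  have hg : 0 < g := by
    refine lt_of_le_of_ne ?_ fun h => hv₀ ?_
    · exact Int.nonneg_of_normalize_eq_self Finset.normalize_gcd
    · rw [hqp v₀ (Finset.mem_univ _), ← h]; simp
  have hqp' : q = g • p := funext fun v => hqp v (Finset.mem_univ v)
  refine ⟨p, ?_, fun v => ?_, fun d hd => ?_⟩
  · rw [hqp', Matrix.mulVec_smul] at hq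
    exact (smul_eq_zero.1 hq).resolve_left hg.ne'
  · have := hnn v
    rw [hqp v (Finset.mem_univ v)] at this
    exact nonneg_of_mul_nonneg_right this hg
  · exact isUnit_of_dvd_one (hgcd ▸ Finset.dvd_gcd fun v _ => hd v)

/-! ### Recurrence of the rotor walk -/

namespace RotorOrder

variable (r : D.RotorOrder)

/-- The visits to the vertices during a period of the rotor walk define a vector in the kernel of
the Laplacian. -/
theorem exists_visits_eq [Finite E] {c : D.ChipRotorConfig} {k : ℕ}
    (h : r.step^[k] c = c) : ∃ q : V → ℕ, r.visits c k = (fun v => D.outDeg v * q v) ∧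
      D.laplacian.mulVec (fun v => (q v : ℤ)) = 0 := by
  have h2 := r.iterate_step_snd c k
  have h1 := r.single_iterate_step_fst c k
  rw [h] at h1 h2
  obtain ⟨q, hq⟩ := r.exists_eq_outDeg_mul h2.symm
  refine ⟨q, hq, ?_⟩
  rw [hq, flow_outDeg_mul] at h1
  exact left_eq_add.1 h1

/-- Divided by the out-degrees, the visits form a nonnegative kernel vector. It is nonzero because
`k > 0`, hence positive everywhere. -/
theorem visits_pos_of_periodic [Finite E] (hD : D.StronglyConnected) [Nonempty E]
    {c : D.ChipRotorConfig} {k : ℕ} (hk : 0 < k) (h : r.step^[k] c = c) (v : V) :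
    0 < r.visits c k v := by
  obtain ⟨q, hq, hker⟩ := r.exists_visits_eq h
  have hne : (fun v => (q v : ℤ)) ≠ 0 := by
    intro h0
    have hq0 : ∀ v, q v = 0 := fun v => Int.natCast_eq_zero.1 (congrFun h0 v)
    have := r.sum_visits c k
    simp [hq, hq0] at this
    omega
  have := hD.pos_of_ne_zero hker (fun v => Int.natCast_nonneg _) hne v
  rw [hq]
  exact Nat.mul_pos (hD.outDeg_pos v) (by exact_mod_cast this)

theorem exists_periodic [Finite E] (c : D.ChipRotorConfig) :
    ∃ i k, 0 < k ∧ r.step^[k] (r.step^[i] c) = r.step^[i] c := by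
  obtain ⟨i, j, hij, h⟩ := Finite.exists_ne_map_eq_of_infinite fun k : ℕ => r.step^[k] c
  wlog hlt : i < j generalizing i j
  · exact this j i hij.symm h.symm (by omega)
  refine ⟨i, j - i, by omega, ?_⟩
  rw [← Function.iterate_add_apply, Nat.sub_add_cancel hlt.le]
  exact h.symm

/-- The rotor walk visits every vertex. -/
theorem exists_visits_pos [Finite E] (hD : D.StronglyConnected) [Nonempty E]
    (c : D.ChipRotorConfig) : ∃ k, ∀ v, 0 < r.visits c k v := by
  obtain ⟨i, k, hk, h⟩ := r.exists_periodic c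
  refine ⟨i + k, fun v => ?_⟩
  rw [visits_add]
  exact Nat.add_pos_right _ (r.visits_pos_of_periodic hD hk h v)

theorem exists_iterate_fst_eq [Finite E] (hD : D.StronglyConnected) [Nonempty E]
    (c : D.ChipRotorConfig) (v : V) : ∃ k, (r.step^[k] c).1 = v := by
  obtain ⟨k, hk⟩ := r.exists_visits_pos hD c
  have := hk v
  rw [visits_apply, Finset.card_pos] at this
  obtain ⟨i, hi⟩ := this
  exact ⟨i, (Finset.mem_filter.1 hi).2⟩

end RotorOrder

/-- A periodic stretch of any rotor walk supplies a nonzero nonnegative kernel vector, which is then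
made primitive. -/
theorem StronglyConnected.exists_isPeriodVector [Finite E] [Nonempty E]
    (hD : D.StronglyConnected) (r : D.RotorOrder) : ∃ p : V → ℤ, D.IsPeriodVector p := by
  obtain ⟨ϱ⟩ := hD.nonempty_rotorConfig
  obtain ⟨e⟩ := ‹Nonempty E›
  obtain ⟨i, k, hk, h⟩ := r.exists_periodic (D.src e, ϱ)
  obtain ⟨q, hq, hker⟩ := r.exists_visits_eq h
  refine MultiDigraph.exists_isPeriodVector hker (fun v => Int.natCast_nonneg _) fun h0 => ?_
  have hq0 : ∀ v, q v = 0 := fun v => Int.natCast_eq_zero.1 (congrFun h0 v)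
  have := r.sum_visits (r.step^[i] (D.src e, ϱ)) k
  simp [hq, hq0] at this
  omega

end MultiDigraph

namespace MultiDigraph

variable {V E : Type*} {D : MultiDigraph V E} [Fintype V] [DecidableEq V]

namespace RotorOrder

variable (r : D.RotorOrder)

/-! ### Rotor-router orbits and the Picard group -/

theorem edgeFlow_mem_imLaplacian [Finite E] {e : E} {n : ℕ} (h : r.next^[n] e = e) :
    r.edgeFlow e n ∈ D.imLaplacian := by
  obtain ⟨q, rfl⟩ : D.outDeg (D.src e) ∣ n := by
    rw [← r.minimalPeriod_next]
    exact Function.IsPeriodicPt.minimalPeriod_dvd h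
  rw [edgeFlow_outDeg_mul]
  exact ⟨_, rfl⟩

/-- Two rotations with the same outcome differ by full turns. -/
theorem edgeFlow_sub_mem_imLaplacian [Finite E] {e : E} {m n : ℕ}
    (h : r.next^[m] e = r.next^[n] e) : r.edgeFlow e m - r.edgeFlow e n ∈ D.imLaplacian := by
  wlog hle : n ≤ m generalizing m n
  · rw [← neg_sub]
    exact neg_mem (this h.symm (by omega))
  obtain ⟨t, rfl⟩ := Nat.exists_eq_add_of_le hle
  rw [edgeFlow_add, add_sub_cancel_left]
  apply r.edgeFlow_mem_imLaplacian
  rw [← Function.iterate_add_apply, add_comm, h]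

/-- Modulo the image of the Laplacian, the flow of a rotation is the change of a function of the
rotor configuration. -/
theorem exists_potential [Finite E] (ϱ₀ : D.RotorConfig) :
    ∃ H : D.RotorConfig → V → ℤ, (∀ ϱ, ∑ v, H ϱ v = 0) ∧
      ∀ z ϱ, r.flow z ϱ + H (r.rotate z ϱ) - H ϱ ∈ D.imLaplacian := by
  have (e : E) : ∃ n : ℕ, r.next^[n] e = ϱ₀.1 (D.src e) :=
    r.exists_iterate_next (ϱ₀.2 _).symm
  choose n hn using this
  -- The potential of `ϱ` is the flow of a rotation that brings it to the reference configuration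
  -- `ϱ₀`.
  refine ⟨fun ϱ => ∑ u, r.edgeFlow (ϱ.1 u) (n (ϱ.1 u)), fun ϱ => ?_, fun z ϱ => ?_⟩
  · simp only [Finset.sum_apply]
    rw [Finset.sum_comm]
    simp [sum_edgeFlow]
  · rw [flow, ← Finset.sum_add_distrib, ← Finset.sum_sub_distrib]
    refine sum_mem fun u _ => ?_
    change r.edgeFlow (ϱ.1 u) (z u) + r.edgeFlow (r.next^[z u] (ϱ.1 u)) _ - _ ∈ _
    rw [← edgeFlow_add]
    apply r.edgeFlow_sub_mem_imLaplacian
    rw [add_comm, Function.iterate_add_apply]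
    change r.next^[n (r.next^[z u] (ϱ.1 u))] (r.next^[z u] (ϱ.1 u)) = _
    rw [hn, hn, r.src_iterate_next]

/-- Induction on the total debt: a chip from a vertex with a positive entry is walked to a vertex in
debt. Without debt, total `1` means a single chip. -/
theorem exists_flow_eq_single [Finite E] [Nonempty E] (hD : D.StronglyConnected)
    (x : V → ℤ) (hx : ∑ v, x v = 1) (ϱ : D.RotorConfig) :
    ∃ z w, x + r.flow z ϱ = Pi.single w 1 := by
  obtain ⟨n, hn⟩ : ∃ n, ∑ v, (-x v).toNat = n := ⟨_, rfl⟩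
  induction n using Nat.strong_induction_on generalizing x ϱ with
  | _ n ih =>
  obtain ⟨u, hu⟩ : ∃ u, 0 < x u := by
    by_contra! h
    have := Finset.sum_nonpos fun v (_ : v ∈ Finset.univ) => h v
    omega
  by_cases hneg : ∃ v, x v < 0
  · obtain ⟨v, hv⟩ := hneg
    have huv : u ≠ v := by rintro rfl; omega
    obtain ⟨k, hk⟩ := r.exists_iterate_fst_eq hD (u, ϱ) v
    have hfl := r.single_iterate_step_fst (u, ϱ) k
    rw [hk] at hfl
    set z := r.visits (u, ϱ) k
    have hx' : ∀ a, (x + r.flow z ϱ) a =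
        x a + (Pi.single v 1 : V → ℤ) a - (Pi.single u 1 : V → ℤ) a := by
      intro a
      rw [hfl, Pi.add_apply, Pi.add_apply]
      ring
    obtain ⟨z', w, h⟩ := ih (∑ a, (-(x + r.flow z ϱ) a).toNat) (by
        rw [← hn]
        refine Finset.sum_lt_sum (fun a _ => ?_) ⟨v, Finset.mem_univ v, ?_⟩
        · rw [hx']
          by_cases h1 : a = u
          · subst h1; simp [huv]; omega
          · by_cases h2 : a = v
            · subst h2; simp [h1]
            · simp [h1, h2]
        · rw [hx']
          simp [huv.symm]
          omega)
      (x + r.flow z ϱ) (by simp only [hx', Finset.sum_sub_distrib, Finset.sum_add_distrib]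
                           simp [hx]) (r.rotate z ϱ) rfl
    exact ⟨z + z', w, by rw [flow_add, ← add_assoc, h]⟩
  · push Not at hneg
    refine ⟨0, u, ?_⟩
    rw [flow_zero, add_zero]
    rw [← Finset.add_sum_erase _ _ (Finset.mem_univ u)] at hx
    have h0 : 0 ≤ ∑ v ∈ Finset.univ.erase u, x v := Finset.sum_nonneg fun v _ => hneg v
    have h0' : ∑ v ∈ Finset.univ.erase u, x v = 0 := by omega
    funext v
    by_cases hv : v = u
    · subst hv; simp; omega
    · rw [Pi.single_eq_of_ne hv]
      exact (Finset.sum_eq_zero_iff_of_nonneg fun v _ => hneg v).1 h0' v (by simp [hv])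

/-- Every chip configuration with one chip in total can be routed to a unicycle. -/
theorem exists_flow_eq_isUnicycle [Finite E] [Nonempty E] (hD : D.StronglyConnected)
    (x : V → ℤ) (hx : ∑ v, x v = 1) (ϱ : D.RotorConfig) :
    ∃ z w, x + r.flow z ϱ = Pi.single w 1 ∧ D.IsUnicycle (w, r.rotate z ϱ) := by
  obtain ⟨z, w, hz⟩ := r.exists_flow_eq_single hD x hx ϱ
  -- A walk that has visited every vertex is in a unicycle.
  obtain ⟨k, hk⟩ := r.exists_visits_pos hD (w, r.rotate z ϱ)
  refine ⟨z + r.visits (w, r.rotate z ϱ) k, (r.step^[k] (w, r.rotate z ϱ)).1, ?_, ?_⟩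
  · rw [single_iterate_step_fst, flow_add, ← add_assoc, hz]
  · rw [rotate_add, ← r.iterate_step_snd (w, r.rotate z ϱ) k]
    exact r.isUnicycle_of_visits_pos hk

/-- The elements of the Picard group classify the unicycles up to rotor-routing. -/
theorem exists_classifying_map [Finite E] [Nonempty E] (hD : D.StronglyConnected) :
    ∃ Ψ : {c : D.ChipRotorConfig // D.IsUnicycle c} → D.Pic0, Function.Surjective Ψ ∧
      ∀ c c', Ψ c = Ψ c' ↔ ∃ k, r.step^[k] c.1 = c'.1 := by
  obtain ⟨p, hp⟩ := hD.exists_isPeriodVector r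
  obtain ⟨ϱ₀⟩ := hD.nonempty_rotorConfig
  obtain ⟨H, hsum, hH⟩ := r.exists_potential ϱ₀
  obtain ⟨w₀⟩ : Nonempty V := ⟨D.src (Classical.arbitrary E)⟩
  have hmem (c : D.ChipRotorConfig) :
      (Pi.single c.1 1 - Pi.single w₀ 1 + H c.2 : V → ℤ) ∈ degreeZero V := by
    change ∑ v, (Pi.single c.1 1 - Pi.single w₀ 1 + H c.2 : V → ℤ) v = 0
    simp [Finset.sum_add_distrib, hsum]
  have hmk (x y : degreeZero V) : (Submodule.Quotient.mk x : D.Pic0) = Submodule.Quotient.mk y ↔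
      (x : V → ℤ) - y ∈ D.imLaplacian := Submodule.Quotient.eq _
  refine ⟨fun c => Submodule.Quotient.mk ⟨_, hmem c.1⟩, fun q => ?_, ?_⟩
  · obtain ⟨⟨x, hx⟩, rfl⟩ := Submodule.Quotient.mk_surjective _ q
    have hx' : ∑ v, x v = 0 := hx
    -- The start is chosen so that base point and potential cancel, leaving the class of `x`.
    obtain ⟨z, w, hz, huni⟩ := r.exists_flow_eq_isUnicycle hD (x + Pi.single w₀ 1 - H ϱ₀)
      (by simp [Finset.sum_add_distrib, hsum, hx']) ϱ₀
    refine ⟨⟨_, huni⟩, (hmk _ _).2 ?_⟩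
    convert hH z ϱ₀ using 1
    simp only [← hz]
    abel
  · rintro ⟨⟨w, ϱ⟩, hc⟩ ⟨⟨w', ϱ'⟩, hc'⟩
    rw [hmk]
    constructor
    · intro h
      obtain ⟨z, rfl⟩ := r.exists_rotate_eq ϱ ϱ'
      obtain ⟨y, hy⟩ : Pi.single w' 1 - Pi.single w 1 - r.flow z ϱ ∈ D.imLaplacian := by
        have := neg_mem (add_mem h (hH z ϱ))
        convert this using 1
        simp only
        abel
      -- The numbers `y` of full turns may be negative; adding `N` times the positive kernel vector
      -- `p` makes them admissible without changing the flow.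
      obtain ⟨N, hN⟩ : ∃ N : ℕ, ∀ v, -y v ≤ N := by
        refine ⟨∑ v, (-y v).toNat, fun v => ?_⟩
        have := Finset.single_le_sum (f := fun v => (-y v).toNat) (fun _ _ => Nat.zero_le _)
          (Finset.mem_univ v)
        omega
      let q : V → ℕ := fun v => (y v + N * p v).toNat
      have hq : (fun v => (q v : ℤ)) = y + (N : ℤ) • p := by
        funext v
        have h1 := hp.pos hD v
        have h2 := hN v
        have h3 : (N : ℤ) ≤ N * p v := le_mul_of_one_le_right (by positivity) h1
        simp only [q, Pi.add_apply, Pi.smul_apply, smul_eq_mul]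
        omega
      have hrot : r.rotate ((fun v => D.outDeg v * q v) + z) ϱ = r.rotate z ϱ := by
        rw [rotate_add, rotate_outDeg_mul]
      have := r.iterate_step_of_flow_eq (w := w) (w' := w') (ϱ := ϱ)
        (z := (fun v => D.outDeg v * q v) + z) (by
          rw [flow_add, flow_outDeg_mul, rotate_outDeg_mul, hq, Matrix.mulVec_add,
            Matrix.mulVec_smul, hp.laplacian_mulVec, smul_zero, add_zero]
          change D.laplacian.mulVec y = _ at hy
          rw [hy]
          abel) (by rw [hrot]; exact hc')
      exact ⟨_, by rw [this.1, hrot]⟩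
    · rintro ⟨k, hk⟩
      have h1 := r.single_iterate_step_fst (w, ϱ) k
      have h2 := r.iterate_step_snd (w, ϱ) k
      simp only at hk h1 h2
      rw [hk] at h1 h2
      simp only at h1 h2
      have := neg_mem (hH (r.visits (w, ϱ) k) ϱ)
      rw [← h2] at this
      convert this using 1
      simp only [h1]
      abel

/-! ### The period of the rotor walk -/

variable {r} in
-- Turning each rotor `P v` times moves neither rotors nor chip, so the walk realizes it as a
-- period. Conversely, any period comes from a multiple `t • P`, and `t ≥ 1` for the minimal one
-- because it has positive length.
theorem period_of_isUnicycle [Finite E] [Nonempty E] (hD : D.StronglyConnected) {P : V → ℕ}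
    (hP : D.IsPeriodVector fun v => (P v : ℤ)) {c : D.ChipRotorConfig} (hc : D.IsUnicycle c) :
    Function.minimalPeriod r.step c = ∑ v, D.outDeg v * P v ∧
      r.visits c (∑ v, D.outDeg v * P v) = fun v => D.outDeg v * P v := by
  obtain ⟨w, ϱ⟩ := c
  have hrot := r.rotate_outDeg_mul P ϱ
  obtain ⟨h1, h2⟩ := r.iterate_step_of_flow_eq (w := w) (w' := w) (ϱ := ϱ)
    (z := fun v => D.outDeg v * P v)
    (by rw [flow_outDeg_mul, hP.laplacian_mulVec, add_zero]) (by rw [hrot]; exact hc)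
  rw [hrot] at h1
  have hpos : 0 < ∑ v, D.outDeg v * P v := by
    refine Finset.sum_pos (fun v _ => Nat.mul_pos (hD.outDeg_pos v) ?_) ⟨w, Finset.mem_univ w⟩
    exact_mod_cast hP.pos hD v
  refine ⟨le_antisymm (Function.IsPeriodicPt.minimalPeriod_le hpos h1) ?_, h2⟩
  have hm : 0 < Function.minimalPeriod r.step (w, ϱ) :=
    Function.IsPeriodicPt.minimalPeriod_pos hpos h1
  obtain ⟨q, hq, hker⟩ := r.exists_visits_eq (Function.iterate_minimalPeriod (f := r.step)
    (x := (w, ϱ)))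
  obtain ⟨t, ht⟩ := hP.exists_eq_smul hD hker
  have hvis := r.sum_visits (w, ϱ) (Function.minimalPeriod r.step (w, ϱ))
  rw [hq] at hvis
  have ht0 : 1 ≤ t := by
    by_contra! hlt
    have hq0 : ∀ v, q v = 0 := fun v => by
      have h := congrFun ht v
      simp only [Pi.smul_apply, smul_eq_mul] at h
      have : t * (P v : ℤ) ≤ 0 := mul_nonpos_of_nonpos_of_nonneg (by omega) (by positivity)
      omega
    simp [hq0] at hvis
    omega
  rw [← hvis]
  refine Finset.sum_le_sum fun v _ => Nat.mul_le_mul_left _ ?_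
  have h := congrFun ht v
  simp only [Pi.smul_apply, smul_eq_mul] at h
  have : (P v : ℤ) ≤ t * P v := le_mul_of_one_le_left (by positivity) ht0
  omega

end RotorOrder

/-! ### Counting -/

theorem finite_pic0 [Finite E] [Nonempty E] (hD : D.StronglyConnected) (r : D.RotorOrder) :
    Finite D.Pic0 := by
  obtain ⟨Ψ, hΨ, -⟩ := r.exists_classifying_map hD
  exact Finite.of_surjective Ψ hΨ

theorem card_pic0_eq_numUnicycleOrbits [Finite E] [Nonempty E] (hD : D.StronglyConnected)
    (r : D.RotorOrder) : Nat.card D.Pic0 = r.numUnicycleOrbits := by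
  obtain ⟨Ψ, hΨ, hiff⟩ := r.exists_classifying_map hD
  -- The fibres of `Ψ` are exactly the unicycle-orbits.
  let F : D.Pic0 → Set D.ChipRotorConfig := fun q => {c | ∃ h : D.IsUnicycle c, Ψ ⟨c, h⟩ = q}
  have hF (c) (hc : D.IsUnicycle c) : F (Ψ ⟨c, hc⟩) = r.orbit c := by
    ext c'
    constructor
    · rintro ⟨h, hcc'⟩
      exact (hiff ⟨c, hc⟩ ⟨c', h⟩).1 hcc'.symm
    · rintro ⟨k, rfl⟩
      have h := r.isUnicycle_iterate_step hc k
      exact ⟨h, ((hiff ⟨c, hc⟩ ⟨_, h⟩).2 ⟨k, rfl⟩).symm⟩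
  have hinj : Function.Injective F := by
    intro q q' h
    obtain ⟨⟨c, hc⟩, rfl⟩ := hΨ q
    have hmem : c ∈ F (Ψ ⟨c, hc⟩) := ⟨hc, rfl⟩
    rw [h] at hmem
    exact hmem.2
  have hrange : {O : Set D.ChipRotorConfig | ∃ c, D.IsUnicycle c ∧ O = r.orbit c} =
      Set.range F := by
    ext O
    constructor
    · rintro ⟨c, hc, rfl⟩
      exact ⟨_, hF c hc⟩
    · rintro ⟨q, rfl⟩
      obtain ⟨⟨c, hc⟩, rfl⟩ := hΨ q
      exact ⟨c, hc, hF c hc⟩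
  rw [RotorOrder.numUnicycleOrbits, hrange, ← Nat.card_coe_set_eq]
  exact Nat.card_congr (Equiv.ofInjective F hinj)

/-- Double count of the unicycles with the chip at `w`: by arborescences, and by orbits. An orbit
contributes one for each visit to `w` during a period, and these are distinct within the minimal
period. -/
theorem card_pic0_mul [Finite E] [Nonempty E] (hD : D.StronglyConnected) (r : D.RotorOrder)
    {P : V → ℕ} (hP : D.IsPeriodVector fun v => (P v : ℤ)) (w : V) :
    Nat.card D.Pic0 * P w = D.numInArborescences w := by
  have := finite_pic0 hD r
  have := Fintype.ofFinite D.Pic0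
  obtain ⟨Ψ, hΨ, hiff⟩ := r.exists_classifying_map hD
  let X := {ϱ : D.RotorConfig // D.IsUnicycle (w, ϱ)}
  let g : X → D.Pic0 := fun ϱ => Ψ ⟨(w, ϱ.1), ϱ.2⟩
  have hfib (q : D.Pic0) : Nat.card {ϱ : X // g ϱ = q} = D.outDeg w * P w := by
    obtain ⟨⟨c, hc⟩, rfl⟩ := hΨ q
    obtain ⟨hper, hvis⟩ := RotorOrder.period_of_isUnicycle (r := r) hD hP hc
    have hpos : 0 < ∑ v, D.outDeg v * P v := by
      refine Finset.sum_pos (fun v _ => Nat.mul_pos (hD.outDeg_pos v) ?_) ⟨w, Finset.mem_univ w⟩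
      exact_mod_cast hP.pos hD v
    set K := ∑ v, D.outDeg v * P v
    rw [← congrFun hvis w, r.visits_apply, ← Nat.card_eq_finsetCard]
    have hprop (i : {i // i ∈ (Finset.range K).filter fun i => (r.step^[i] c).1 = w}) :
        r.step^[i.1] c = (w, (r.step^[i.1] c).2) :=
      Prod.ext (Finset.mem_filter.1 i.2).2 rfl
    have huni (i : {i // i ∈ (Finset.range K).filter fun i => (r.step^[i] c).1 = w}) :
        D.IsUnicycle (w, (r.step^[i.1] c).2) := by
      rw [← hprop i]; exact r.isUnicycle_iterate_step hc i.1
    symm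
    refine Nat.card_congr (Equiv.ofBijective (fun i => ⟨⟨(r.step^[i.1] c).2, huni i⟩,
      ((hiff ⟨c, hc⟩ ⟨_, huni i⟩).2 ⟨i.1, hprop i⟩).symm⟩) ⟨fun i j hij => ?_, ?_⟩)
    · have hij' : (r.step^[i.1] c).2 = (r.step^[j.1] c).2 := congrArg (fun x => x.1.1) hij
      have h : r.step^[i.1] c = r.step^[j.1] c := by rw [hprop i, hprop j, hij']
      have hi := (Finset.mem_filter.1 i.2).1
      have hj := (Finset.mem_filter.1 j.2).1
      exact Subtype.ext (Function.iterate_injOn_Iio_minimalPeriod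
        (by simpa [hper] using hi) (by simpa [hper] using hj) h)
    · rintro ⟨⟨ϱ, hϱ⟩, hq⟩
      obtain ⟨k, hk⟩ := (hiff ⟨c, hc⟩ ⟨_, hϱ⟩).1 hq.symm
      simp only at hk
      have hk' : r.step^[k % K] c = (w, ϱ) := by
        rw [← hper, Function.iterate_mod_minimalPeriod_eq, hk]
      refine ⟨⟨k % K, ?_⟩, ?_⟩
      · rw [Finset.mem_filter, Finset.mem_range, hk']
        exact ⟨Nat.mod_lt _ hpos, rfl⟩
      · simp only [hk']
  have hcard : Nat.card X = Nat.card D.Pic0 * (D.outDeg w * P w) := by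
    rw [← Nat.card_congr (Equiv.sigmaFiberEquiv g), Nat.card_sigma]
    simp [hfib]
  have hX : Nat.card X = _ := card_isUnicycle w
  rw [hX] at hcard
  apply Nat.eq_of_mul_eq_mul_left (hD.outDeg_pos w)
  rw [hcard]
  ring

end MultiDigraph

theorem mainTheorem4 {V E : Type*} [Fintype V] [DecidableEq V] [Finite E] [Nonempty E]
    (D : MultiDigraph V E) (hD : D.StronglyConnected) (r : D.RotorOrder) :
    Finite D.Pic0 ∧
    Nat.card D.Pic0 = r.numUnicycleOrbits ∧
    (∃! p : V → ℤ, D.IsPeriodVector p) ∧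
    ∀ p : V → ℤ, D.IsPeriodVector p → ∀ w : V, 0 < p w ∧
      (Nat.card D.Pic0 : ℚ) = (D.numInArborescences w : ℚ) / (p w : ℚ) := by
  refine ⟨MultiDigraph.finite_pic0 hD r, MultiDigraph.card_pic0_eq_numUnicycleOrbits hD r, ?_,
    fun p hp w => ⟨hp.pos hD w, ?_⟩⟩
  · obtain ⟨p, hp⟩ := hD.exists_isPeriodVector r
    exact ⟨p, hp, fun q hq => hp.unique hD hq⟩
  · obtain ⟨P, rfl⟩ : ∃ P : V → ℕ, p = fun v => (P v : ℤ) :=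
      ⟨fun v => (p v).toNat, funext fun v => (Int.toNat_of_nonneg (hp.nonneg v)).symm⟩
    have hw : (P w : ℚ) ≠ 0 := by exact_mod_cast (hp.pos hD w).ne'
    rw [← MultiDigraph.card_pic0_mul hD r hp w]
    push_cast
    rw [mul_div_cancel_right₀ _ hw]
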